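/- \textbf{Setting.} Let $p_0=(0,0)$, $p_1=(1,0)$, $p_2=(\tfrac12,\tfrac{\sqrt3}2)$ and $f_i(x)=\tfrac12(x+p_i)$ for $x\in\mathbb R^2$, $i=0,1,2$. Let $K$ be the Sierpiński gasket, i.e. the unique nonempty compact set with $K=f_0(K)\cup f_1(K)\cup f_2(K)$. For a finite word $w=w_1\cdots w_n$ over $\{0,1,2\}$ write $|w|=n$, $f_w=f_{w_1}\circ\cdots\circ f_{w_n}$ (with $f_\emptyset=\mathrm{id}$), $K_w=f_w(K)$ and, if $n\ge1$, $w^-=w_1\cdots w_{n-1}$ and $\Phi_n(w)=f_{w^-}(p_{w_n})$. The Sierpiński graph $X$ has all finite words as vertices, with the empty word $o$ as root. Its edges are the vertical edges, joining $w$ and $w^-$ for every $w\neq o$, and the horizontal edges, joining distinct words $x,y$ with $|x|=|y|=n\ge1$ and $K_x\cap K_y\ne\emptyset$; a horizontal edge is of type I if $\Phi_n(x)\neq\Phi_n(y)$ and of type II if $\Phi_n(x)=\Phi_n(y)$. Let $\lambda>0$ and $C_1,C_2>0$. Define symmetric conductances on $X$ by $c(x,y)=(3\lambda)^{-n}$ for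 a vertical edge with $\{|x|,|y|\}=\{n,n+1\}$; $c(x,y)=C_1(3\lambda)^{-n}$, respectively $C_2(3\lambda)^{-n}$, for a horizontal edge of type I, respectively type II, with $|x|=|y|=n$; and $c(x,y)=0$ if $x,y$ are not adjacent. Let $P(x,y)=c(x,y)/\sum_z c(x,z)$ be the transition probabilities of the associated random walk, $G(x,y)=\sum_{n\ge0}P^{(n)}(x,y)$ its Green function and $K(x,y)=G(x,y)/G(o,y)$ its Martin kernel. Let $\overline X$ be the Martin compactification, i.e. the smallest compactification of the discrete space $X$ to which all the functions $K(x,\cdot)$, $x\in X$, extend continuously, and let $\partial X=\overline X\setminus X$ be the Martin boundary. \textbf{Theorem.} Suppose $0<\lambda<\tfrac15$. If $u:\overline X\to\mathbb R$ is continuous and $$\frac12\sum_{x,y\in X}c(x,y)\,(u(x)-u(y))^2<+\infty,$$ then $u|_{\partial X}$ is constant. -/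

import Mathlib

open scoped ENNReal

noncomputable section

namespace SierpinskiWalk

/-- Finite words over `{0, 1, 2}`; these are the nodes of the Sierpinski graph.
The word `w₁ … wₙ` is the list `[w₁, …, wₙ]`, and the root `o` is `[]`. -/
abbrev Word : Type := List (Fin 3)

/-- The Euclidean plane. -/
abbrev Plane : Type := EuclideanSpace ℝ (Fin 2)

/-- The points `p₀ = (0, 0)`, `p₁ = (1, 0)`, `p₂ = (1/2, √3/2)`. -/
def corner : Fin 3 → Plane :=
  ![!₂[0, 0], !₂[1, 0], !₂[1 / 2, Real.sqrt 3 / 2]]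

/-- The contractions `fᵢ(x) = (x + pᵢ) / 2`. -/
def contr (i : Fin 3) (x : Plane) : Plane := (1 / 2 : ℝ) • (x + corner i)

/-- `gasketVertices n` is the finite set `V_{n+1}`. -/
def gasketVertices : ℕ → Set Plane
  | 0 => Set.range corner
  | n + 1 => ⋃ i : Fin 3, contr i '' gasketVertices n

/-- The Sierpinski gasket, as the closure of the union of the sets `Vₙ`. It is the unique nonempty
compact set with `K = f₀(K) ∪ f₁(K) ∪ f₂(K)`: see `eq_gasket_iff` below. -/
def gasket : Set Plane := closure (⋃ n, gasketVertices n)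

/-- `f_w = f_{w₁} ∘ … ∘ f_{wₙ}`. -/
def wordMap : Word → Plane → Plane
  | [] => id
  | i :: w => contr i ∘ wordMap w

/-- The cell `K_w = f_w(K)`. -/
def cell (w : Word) : Set Plane := wordMap w '' gasket

/-- `Φₙ(w) = p_w = f_{w₁ … wₙ₋₁}(p_{wₙ})`, for words of length `n ≥ 1`
(the value at the empty word is never used). -/
def vertexPoint (w : Word) : Plane := wordMap w.dropLast (corner (w.getLastD 0))

/-- `x` is the father node of `y`, that is `x = y⁻`. -/
def IsFather (x y : Word) : Prop := y ≠ [] ∧ x = y.dropLast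

/-- Horizontal edges. -/
def HorizontalEdge (x y : Word) : Prop :=
  x.length = y.length ∧ x ≠ y ∧ (cell x ∩ cell y).Nonempty

/-- The Sierpinski graph. -/
def sierpinskiGraph : SimpleGraph Word where
  Adj x y := (IsFather x y ∨ IsFather y x) ∨ HorizontalEdge x y
  symm := by
    constructor
    rintro x y (h | ⟨h1, h2, h3⟩)
    · exact Or.inl h.symm
    · exact Or.inr ⟨h1.symm, h2.symm, by rwa [Set.inter_comm]⟩
  loopless := by
    constructor
    rintro x ((⟨h, h'⟩ | ⟨h, h'⟩) | h)
    · have := congrArg List.length h'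
      have := List.length_pos_iff.mpr h
      simp at *
      omega
    · have := congrArg List.length h'
      have := List.length_pos_iff.mpr h
      simp at *
      omega
    · exact h.2.1 rfl

open Classical in
/-- The conductance: `1/(3λ)ⁿ` on a vertical edge between levels `n` and `n + 1`, and, on a
horizontal edge at level `n`, `C₁/(3λ)ⁿ` for type I (different images under `Φₙ`) and
`C₂/(3λ)ⁿ` for type II (equal images under `Φₙ`). It vanishes off the edges. -/
def conductance (lam C₁ C₂ : ℝ) (x y : Word) : ℝ :=
  if IsFather x y then 1 / (3 * lam) ^ x.length
  else if IsFather y x then 1 / (3 * lam) ^ y.length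
  else if HorizontalEdge x y then
    (if vertexPoint x ≠ vertexPoint y then C₁ else C₂) / (3 * lam) ^ x.length
  else 0

/-- The conductance is positive exactly on the edges of the Sierpinski graph. -/
theorem conductance_pos_iff {lam C₁ C₂ : ℝ} (hlam : 0 < lam) (hC₁ : 0 < C₁) (hC₂ : 0 < C₂)
    (x y : Word) : 0 < conductance lam C₁ C₂ x y ↔ sierpinskiGraph.Adj x y := by
  have h (n : ℕ) : 0 < (3 * lam) ^ n := by positivity
  unfold conductance sierpinskiGraph
  split_ifs with h1 h2 h3 h4
  · simp [h1, h]
  · simp [h2, h]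
  · simp [h3, h, hC₁]
  · simp [h3, h, hC₂]
  · simp [h1, h2, h3]

/-- The total conductance `π(x) = ∑_y c(x, y)`. -/
def totalConductance (lam C₁ C₂ : ℝ) (x : Word) : ℝ≥0∞ :=
  ∑' y, ENNReal.ofReal (conductance lam C₁ C₂ x y)

/-- The transition probability `P(x, y) = c(x, y) / π(x)`. -/
def transition (lam C₁ C₂ : ℝ) (x y : Word) : ℝ≥0∞ :=
  ENNReal.ofReal (conductance lam C₁ C₂ x y) / totalConductance lam C₁ C₂ x

open Classical in
/-- The `n`-step transition probabilities `P⁽ⁿ⁾(x, y)`. -/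
def nStep (lam C₁ C₂ : ℝ) : ℕ → Word → Word → ℝ≥0∞
  | 0, x, y => if x = y then 1 else 0
  | n + 1, x, y => ∑' z, transition lam C₁ C₂ x z * nStep lam C₁ C₂ n z y

/-- The Green function `G(x, y) = ∑ₙ P⁽ⁿ⁾(x, y)`. -/
def green (lam C₁ C₂ : ℝ) (x y : Word) : ℝ≥0∞ := ∑' n, nStep lam C₁ C₂ n x y

/-- The Martin kernel `K(x, y) = G(x, y) / G(o, y)`. -/
def martinKernel (lam C₁ C₂ : ℝ) (x y : Word) : ℝ≥0∞ :=
  green lam C₁ C₂ x y / green lam C₁ C₂ [] y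

open Classical in
/-- The map that sends `y` to the family of the values at `y` of the functions `K(x, ·)` and of
the indicator functions of the points `x`. -/
def martinMap (lam C₁ C₂ : ℝ) (y : Word) : Word → ℝ≥0∞ × Bool :=
  fun x => (martinKernel lam C₁ C₂ x y, decide (x = y))

/-- The Martin compactification: the closure of the nodes in the compact product space. It is
the smallest compactification of the discrete space of nodes to which every `K(x, ·)` extends
continuously: see `isKernelCompactification_martin` and `martin_smallest` below. (As every
`K(x, ·)` is bounded, it makes no difference whether the extensions take values in `[0, ∞)`
or in `[0, ∞]`.) -/
abbrev MartinCompactification (lam C₁ C₂ : ℝ) : Type :=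
  closure (Set.range (martinMap lam C₁ C₂))

/-- The inclusion of the nodes in the Martin compactification. -/
def toMartin (lam C₁ C₂ : ℝ) (x : Word) : MartinCompactification lam C₁ C₂ :=
  ⟨martinMap lam C₁ C₂ x, subset_closure ⟨x, rfl⟩⟩

/-- The Martin boundary: the complement of the nodes in the Martin compactification. -/
def martinBoundary (lam C₁ C₂ : ℝ) : Set (MartinCompactification lam C₁ C₂) :=
  (Set.range (toMartin lam C₁ C₂))ᶜ

/-- The energy `(1/2) ∑_{x, y} c(x, y) (u(x) - u(y))²`, in `[0, ∞]`. -/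
def energy (lam C₁ C₂ : ℝ) (u : Word → ℝ) : ℝ≥0∞ :=
  (1 / 2) * ∑' x, ∑' y, ENNReal.ofReal (conductance lam C₁ C₂ x y * (u x - u y) ^ 2)

/-! The gasket and the Martin compactification have their defining properties. -/

theorem eq_gasket_iff (K : Set Plane) :
    K = gasket ↔ K.Nonempty ∧ IsCompact K ∧ K = ⋃ i, contr i '' K := by
  have hcont : ∀ i, Continuous (contr i) := fun i => by unfold contr; fun_prop
  have hfix : ∀ i, contr i (corner i) = corner i := fun i => by
    unfold contr; rw [← two_smul ℝ, smul_smul]; norm_num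
  have hdist : ∀ i x y, dist (contr i x) (contr i y) = (1 / 2) * dist x y := fun i x y => by
    unfold contr; rw [dist_smul₀, dist_add_right]; norm_num
  have hU : (⋃ n, gasketVertices n) = ⋃ i, contr i '' (⋃ n, gasketVertices n) := by
    apply Set.Subset.antisymm
    · refine Set.iUnion_subset fun n => ?_
      cases n with
      | zero =>
        rintro _ ⟨i, rfl⟩
        exact Set.mem_iUnion.2 ⟨i, corner i, Set.mem_iUnion.2 ⟨0, i, rfl⟩, hfix i⟩
      | succ n =>
        exact Set.iUnion_mono fun i => Set.image_mono (Set.subset_iUnion _ n)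
    · refine Set.iUnion_subset fun i => ?_
      rw [Set.image_iUnion]
      refine Set.iUnion_subset fun n => ?_
      exact (Set.subset_iUnion (fun i => contr i '' gasketVertices n) i).trans
        (Set.subset_iUnion gasketVertices (n + 1))
  have hne : gasket.Nonempty :=
    ⟨corner 0, subset_closure (Set.mem_iUnion.2 ⟨0, 0, rfl⟩)⟩
  have hbd : ∀ n, gasketVertices n ⊆ Metric.closedBall (corner 0) 3 := by
    have h0 : ∀ i, dist (corner i) (corner 0) ≤ 1 := by
      intro i
      rw [EuclideanSpace.dist_eq, Real.sqrt_le_one]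
      have h3 : Real.sqrt 3 ^ 2 = 3 := Real.sq_sqrt (by norm_num)
      fin_cases i <;> simp [corner, Real.dist_eq, div_pow, h3] <;> norm_num
    intro n
    induction n with
    | zero => rintro _ ⟨i, rfl⟩; exact (h0 i).trans (by norm_num)
    | succ n ih =>
      refine Set.iUnion_subset fun i => ?_
      rintro _ ⟨x, hx, rfl⟩
      have h1 := Metric.mem_closedBall.1 (ih hx)
      have h2 := hdist i x (corner i)
      rw [hfix] at h2
      have h3 := dist_triangle x (corner 0) (corner i)
      have h4 := dist_triangle (contr i x) (corner i) (corner 0)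
      have h5 := h0 i
      rw [dist_comm (corner 0)] at h3
      rw [Metric.mem_closedBall]
      linarith
  have hco : IsCompact gasket :=
    (isCompact_closedBall (corner 0) 3).of_isClosed_subset isClosed_closure
      (closure_minimal (Set.iUnion_subset hbd) Metric.isClosed_closedBall)
  have hss : gasket = ⋃ i, contr i '' gasket := by
    apply Set.Subset.antisymm
    · refine closure_minimal ?_ (isClosed_iUnion_of_finite fun i =>
        (hco.image (hcont i)).isClosed)
      rw [hU]
      exact Set.iUnion_mono fun i => Set.image_mono subset_closure
    · refine Set.iUnion_subset fun i => ?_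
      refine (image_closure_subset_closure_image (hcont i)).trans (closure_mono ?_)
      conv_rhs => rw [hU]
      exact Set.subset_iUnion (fun i => contr i '' (⋃ n, gasketVertices n)) i
  -- a bounded set contained in the union of its images lies in a closed set containing its images
  have key : ∀ A B : Set Plane, Bornology.IsBounded A → IsClosed B → B.Nonempty →
      Bornology.IsBounded B → A ⊆ ⋃ i, contr i '' A → (∀ i, contr i '' B ⊆ B) → A ⊆ B := by
    intro A B hA hB hBne hBb hAA hBB a ha
    obtain ⟨R, hR⟩ := (Metric.isBounded_iff.1 (hA.union hBb))
    have hclaim : ∀ n : ℕ, ∀ x ∈ A, ∃ y ∈ B, dist x y ≤ (1 / 2) ^ n * R := by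
      intro n
      induction n with
      | zero =>
        intro x hx
        obtain ⟨y, hy⟩ := hBne
        exact ⟨y, hy, by simpa using hR (Or.inl hx) (Or.inr hy)⟩
      | succ n ih =>
        intro x hx
        obtain ⟨i, z, hz, rfl⟩ := Set.mem_iUnion.1 (hAA hx)
        obtain ⟨y, hy, hyz⟩ := ih z hz
        refine ⟨contr i y, hBB i ⟨y, hy, rfl⟩, ?_⟩
        rw [hdist, pow_succ]
        linarith
    rw [← hB.closure_eq, Metric.mem_closure_iff]
    intro ε hε
    have ht : Filter.Tendsto (fun n : ℕ => ((1 / 2 : ℝ)) ^ n * R) Filter.atTop (nhds (0 * R)) :=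
      (tendsto_pow_atTop_nhds_zero_of_lt_one (by norm_num) (by norm_num)).mul_const R
    rw [zero_mul] at ht
    obtain ⟨n, hn⟩ := (ht.eventually_lt_const hε).exists
    obtain ⟨y, hy, hxy⟩ := hclaim n a ha
    exact ⟨y, hy, hxy.trans_lt hn⟩
  constructor
  · rintro rfl
    exact ⟨hne, hco, hss⟩
  · rintro ⟨h1, h2, h3⟩
    apply Set.Subset.antisymm
    · exact key K gasket h2.isBounded hco.isClosed hne hco.isBounded h3.subset
        fun i => (Set.subset_iUnion (fun i => contr i '' gasket) i).trans hss.symm.subset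
    · exact key gasket K hco.isBounded h2.isClosed h1 h2.isBounded hss.subset
        fun i => (Set.subset_iUnion (fun i => contr i '' K) i).trans h3.symm.subset

/-- `j` exhibits `Y` as a (Hausdorff) compactification of the discrete space of nodes to which all
the functions `K(x, ·)` extend continuously. -/
structure IsKernelCompactification (lam C₁ C₂ : ℝ) {Y : Type*} [TopologicalSpace Y]
    (j : Word → Y) : Prop where
  compact : CompactSpace Y
  t2 : T2Space Y
  injective : Function.Injective j
  isOpen_singleton : ∀ x, IsOpen {j x}
  dense : DenseRange j
  extends_kernel : ∀ x, ∃ k : Y → ℝ≥0∞, Continuous k ∧ ∀ y, k (j y) = martinKernel lam C₁ C₂ x y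

theorem isKernelCompactification_martin (lam C₁ C₂ : ℝ) :
    IsKernelCompactification lam C₁ C₂ (toMartin lam C₁ C₂) where
  compact := isCompact_iff_compactSpace.1 isClosed_closure.isCompact
  t2 := inferInstance
  injective := by
    intro x y h
    have := congrFun (congrArg Subtype.val h) x
    simpa [toMartin, martinMap] using (congrArg Prod.snd this).symm
  isOpen_singleton := by
    intro x
    have hd : DenseRange (toMartin lam C₁ C₂) := by
      intro z
      rw [closure_subtype, ← Set.range_comp]
      exact z.2
    have ho : IsOpen {z : MartinCompactification lam C₁ C₂ | (z.1 x).2 = true} :=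
      (isOpen_discrete {true}).preimage
        (continuous_snd.comp ((continuous_apply x).comp continuous_subtype_val))
    have hsub : {z : MartinCompactification lam C₁ C₂ | (z.1 x).2 = true} ⊆
        {toMartin lam C₁ C₂ x} := by
      refine (hd.open_subset_closure_inter ho).trans ?_
      refine closure_minimal ?_ isClosed_singleton
      rintro _ ⟨h, y, rfl⟩
      have : x = y := by simpa [toMartin, martinMap] using h
      rw [this]; rfl
    have heq : {z : MartinCompactification lam C₁ C₂ | (z.1 x).2 = true} =
        {toMartin lam C₁ C₂ x} := by
      refine hsub.antisymm ?_
      rintro _ rfl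
      simp [toMartin, martinMap]
    rw [← heq]
    exact ho
  dense := by
    intro z
    rw [closure_subtype, ← Set.range_comp]
    exact z.2
  extends_kernel := fun x => ⟨fun z => (z.1 x).1,
    continuous_fst.comp ((continuous_apply x).comp continuous_subtype_val), fun _ => rfl⟩

theorem martin_smallest (lam C₁ C₂ : ℝ) {Y : Type*} [TopologicalSpace Y] (j : Word → Y)
    (hj : IsKernelCompactification lam C₁ C₂ j) :
    ∃ g : Y → MartinCompactification lam C₁ C₂, Continuous g ∧
      ∀ x, g (j x) = toMartin lam C₁ C₂ x := by
  classical
  have := hj.t2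
  choose k hk hkj using hj.extends_kernel
  let g : Y → Word → ℝ≥0∞ × Bool := fun z x => (k x z, decide (z = j x))
  have hg : Continuous g := by
    refine continuous_pi fun x => (hk x).prodMk ?_
    have hcl : IsClopen {z | z = j x} := ⟨isClosed_singleton, hj.isOpen_singleton x⟩
    exact (continuous_bool_rng true).2 (by simpa [Set.preimage] using hcl)
  have hgj : ∀ x, g (j x) = martinMap lam C₁ C₂ x := by
    intro x
    funext y
    simp [g, martinMap, hkj, hj.injective.eq_iff, eq_comm]
  have hmem : ∀ z, g z ∈ closure (Set.range (martinMap lam C₁ C₂)) := by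
    intro z
    have h1 := image_closure_subset_closure_image hg ⟨z, hj.dense z, rfl⟩
    refine closure_mono ?_ h1
    rintro _ ⟨_, ⟨x, rfl⟩, rfl⟩
    exact ⟨x, (hgj x).symm⟩
  exact ⟨fun z => ⟨g z, hmem z⟩, hg.subtype_mk hmem, fun x => Subtype.ext (hgj x)⟩

end SierpinskiWalk

end

open scoped ENNReal

namespace SierpinskiWalk

/-! A function of finite energy converges along the cofinite filter on words; since a boundary point
is approached only by nodes that leave every finite set, a continuous `u` takes that single limit
there. The horizontal network on level `n + 1` is three copies of the one on level `n` joined by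
three edges, so corner-to-corner resistance obeys ρ ↦ 5/3 ρ + 1 and grows like (5/3)ⁿ
(`mul_triangleEnergy_diag_le`, `triangleEnergy_corners_le`). Chaining through nested copies bounds
the oscillation on the whole level by a constant times √((5/3)ⁿ · level energy)
(`abs_sub_corner_le`). Horizontal conductances are at least min C₁ C₂ / (3λ)ⁿ, so finite energy
makes the level energy O((3λ)ⁿ) (`levelEnergy_le`), and the oscillation is O(√(5λ)ⁿ), which tends to
0 exactly when λ < 1/5. Along the ray of words 0…0 the vertical edges give increments O(√(3λ)ⁿ),
which are summable; the limit along this ray is the limit of `u`. -/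

/-! ### Resistance of three joined triangles -/

/-- The sum of the squared differences of three numbers. -/
def triangleEnergy (a : Fin 3 → ℝ) : ℝ := (a 0 - a 1) ^ 2 + (a 1 - a 2) ^ 2 + (a 2 - a 0) ^ 2

theorem triangleEnergy_nonneg (a : Fin 3 → ℝ) : 0 ≤ triangleEnergy a := by
  unfold triangleEnergy
  positivity

theorem sq_sub_le_triangleEnergy (a : Fin 3 → ℝ) (i j : Fin 3) :
    (a i - a j) ^ 2 ≤ triangleEnergy a := by
  unfold triangleEnergy
  have h0 := sq_nonneg (a 0 - a 1)
  have h1 := sq_nonneg (a 1 - a 2)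
  have h2 := sq_nonneg (a 2 - a 0)
  fin_cases i <;> fin_cases j <;> simp <;> linarith

/-- The squared differences along the three edges that join the triangles `x 0`, `x 1`, `x 2`. -/
def bridgeEnergy (x : Fin 3 → Fin 3 → ℝ) : ℝ :=
  (x 0 1 - x 1 0) ^ 2 + (x 1 2 - x 2 1) ^ 2 + (x 2 0 - x 0 2) ^ 2

theorem bridgeEnergy_nonneg (x : Fin 3 → Fin 3 → ℝ) : 0 ≤ bridgeEnergy x := by
  unfold bridgeEnergy
  positivity

/-- The energy of a network made of three triangles joined by three edges dominates the energy of
the triangle of its outer corners. -/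
theorem mul_triangleEnergy_diag_le {ρ : ℝ} (hρ : 0 < ρ) (x : Fin 3 → Fin 3 → ℝ) :
    ρ * triangleEnergy (fun i => x i i) ≤
      (5 / 3 * ρ + 1) * (∑ i, triangleEnergy (x i) + ρ * bridgeEnergy x) := by
  -- the deviation of `x` from the harmonic extension of its values at the outer corners
  let y : Fin 3 → Fin 3 → ℝ := fun i j => x i j - if i = j then x i i else
    ((ρ + 3) * x i i + ρ * x j j + ρ * ∑ k, x k k) / (5 * ρ + 3)
  have hQ : 0 ≤ (5 / 3 * ρ + 1) * (∑ i, triangleEnergy (y i) + ρ * bridgeEnergy y) := by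
    have := Finset.sum_nonneg fun i (_ : i ∈ Finset.univ) => triangleEnergy_nonneg (y i)
    have := bridgeEnergy_nonneg y
    positivity
  -- Triangles with edge resistance ρ and unit bridges reduce by star-triangle moves to a triangle
  -- with edge resistance 5/3 ρ + 1. As `y` vanishes at the outer corners, it is energy-orthogonal
  -- to the harmonic extension, so the energies add with no cross term.
  have key : (5 / 3 * ρ + 1) * (∑ i, triangleEnergy (x i) + ρ * bridgeEnergy x) -
      ρ * triangleEnergy (fun i => x i i) =
      (5 / 3 * ρ + 1) * (∑ i, triangleEnergy (y i) + ρ * bridgeEnergy y) := by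
    have hs : 5 * ρ + 3 ≠ 0 := by positivity
    simp only [y, triangleEnergy, bridgeEnergy, Fin.sum_univ_three, if_true,
      show ((0 : Fin 3) = 1) = False by simp, show ((1 : Fin 3) = 0) = False by simp,
      show ((0 : Fin 3) = 2) = False by simp, show ((2 : Fin 3) = 0) = False by simp,
      show ((1 : Fin 3) = 2) = False by simp, show ((2 : Fin 3) = 1) = False by simp, if_false]
    field_simp
    ring
  linarith

/-! ### Oscillation on one level -/

/-- The word `i … i` of length `n`. -/
abbrev cornerWord (n : ℕ) (i : Fin 3) : Word := List.replicate n i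

/-- The energy of `u` on the words of length `n`, with unit conductances on horizontal edges. -/
def levelEnergy : ℕ → (Word → ℝ) → ℝ
  | 0, _ => 0
  | n + 1, u => ∑ i, levelEnergy n (fun w => u (i :: w)) +
      bridgeEnergy (fun i j => u (i :: cornerWord n j))

theorem levelEnergy_nonneg (n : ℕ) (u : Word → ℝ) : 0 ≤ levelEnergy n u := by
  induction n generalizing u with
  | zero => exact le_rfl
  | succ n ih => exact add_nonneg (Finset.sum_nonneg fun i _ => ih _) (bridgeEnergy_nonneg _)

theorem levelEnergy_cons_le (n : ℕ) (u : Word → ℝ) (i : Fin 3) :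
    levelEnergy n (fun w => u (i :: w)) ≤ levelEnergy (n + 1) u :=
  (Finset.single_le_sum (f := fun i => levelEnergy n (fun w => u (i :: w)))
    (fun _ _ => levelEnergy_nonneg n _) (Finset.mem_univ i)).trans
    (le_add_of_nonneg_right (bridgeEnergy_nonneg _))

/-- The factor solves ρ ↦ 5/3 ρ + 1 with initial value 1. At level 0 both energies vanish, so the
initial value is free; it is taken positive because the induction step divides by ρ. -/
theorem triangleEnergy_corners_le (n : ℕ) (u : Word → ℝ) :
    triangleEnergy (fun i => u (cornerWord n i)) ≤
      (5 / 2 * (5 / 3) ^ n - 3 / 2) * levelEnergy n u := by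
  induction n generalizing u with
  | zero => simp [triangleEnergy, levelEnergy]
  | succ n ih =>
    have hρ : (0 : ℝ) < 5 / 2 * (5 / 3) ^ n - 3 / 2 := by
      have : (1 : ℝ) ≤ (5 / 3) ^ n := one_le_pow₀ (by norm_num)
      linarith
    have hsucc : (5 / 2 * (5 / 3) ^ (n + 1) - 3 / 2 : ℝ) =
        5 / 3 * (5 / 2 * (5 / 3) ^ n - 3 / 2) + 1 := by ring
    rw [hsucc]
    set ρ : ℝ := 5 / 2 * (5 / 3) ^ n - 3 / 2
    have h1 := mul_triangleEnergy_diag_le hρ (fun i j => u (i :: cornerWord n j))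
    have h2 : ∑ i, triangleEnergy (fun j => u (i :: cornerWord n j)) ≤
        ρ * ∑ i, levelEnergy n (fun w => u (i :: w)) := by
      rw [Finset.mul_sum]
      exact Finset.sum_le_sum fun i _ => ih fun w => u (i :: w)
    refine le_of_mul_le_mul_left (h1.trans ?_) hρ
    rw [levelEnergy, mul_left_comm, mul_add ρ]
    gcongr

/-- Inside the copy of its first letter `j`, `x` is compared with the corner `j…j`, which is also a
corner of the whole level; one corner-to-corner step then reaches `i…i`. The costs form a geometric
series. -/
theorem abs_sub_corner_le (n : ℕ) (u : Word → ℝ) (x : Word) (hx : x.length = n) (i : Fin 3) :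
    |u x - u (cornerWord n i)| ≤ 10 * √(5 / 3) ^ n * √(levelEnergy n u) := by
  induction n generalizing u x i with
  | zero =>
    rw [List.length_eq_zero_iff.1 hx]
    simp [levelEnergy]
  | succ n ih =>
    obtain _ | ⟨j, x⟩ := x
    · simp at hx
    have hq : (5 / 4 : ℝ) ≤ √(5 / 3) := Real.le_sqrt_of_sq_le (by norm_num)
    have hq2 : √(5 / 3 : ℝ) ^ 2 = 5 / 3 := Real.sq_sqrt (by norm_num)
    have h1 := ih (fun w => u (j :: w)) x (by simpa using hx) j
    have h2 : √(levelEnergy n (fun w => u (j :: w))) ≤ √(levelEnergy (n + 1) u) :=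
      Real.sqrt_le_sqrt (levelEnergy_cons_le n u j)
    have hE := levelEnergy_nonneg (n + 1) u
    have h3 : |u (j :: cornerWord n j) - u (cornerWord (n + 1) i)| ≤
        2 * √(5 / 3) ^ (n + 1) * √(levelEnergy (n + 1) u) := by
      refine abs_le_of_sq_le_sq ?_ (by positivity)
      rw [mul_pow, mul_pow, Real.sq_sqrt hE, pow_right_comm, hq2]
      have h4 := (sq_sub_le_triangleEnergy (fun i => u (cornerWord (n + 1) i)) j i).trans
        (triangleEnergy_corners_le (n + 1) u)
      refine h4.trans (mul_le_mul_of_nonneg_right ?_ hE)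
      have : (0 : ℝ) < (5 / 3) ^ (n + 1) := by positivity
      linarith
    -- The constant 10 closes the induction because 10 ≤ 8 · √(5/3), by √(5/3) ≥ 5/4; the 2 comes
    -- from 5/2 ≤ 2².
    have h5 : 10 * √(5 / 3 : ℝ) ^ n + 2 * √(5 / 3) ^ (n + 1) ≤ 10 * √(5 / 3) ^ (n + 1) := by
      have : (0 : ℝ) < √(5 / 3) ^ n := by positivity
      rw [pow_succ]
      nlinarith
    calc |u (j :: x) - u (cornerWord (n + 1) i)|
        ≤ |u (j :: x) - u (j :: cornerWord n j)| +
          |u (j :: cornerWord n j) - u (cornerWord (n + 1) i)| := abs_sub_le _ _ _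
      _ ≤ 10 * √(5 / 3) ^ n * √(levelEnergy (n + 1) u) +
          2 * √(5 / 3) ^ (n + 1) * √(levelEnergy (n + 1) u) := by
        refine add_le_add (h1.trans ?_) h3
        gcongr
      _ ≤ 10 * √(5 / 3) ^ (n + 1) * √(levelEnergy (n + 1) u) := by
        rw [← add_mul]
        gcongr

/-! ### Level energy against total energy -/

theorem corner_mem_gasket (i : Fin 3) : corner i ∈ gasket :=
  subset_closure (Set.mem_iUnion.2 ⟨0, i, rfl⟩)

theorem wordMap_cornerWord (n : ℕ) (i : Fin 3) : wordMap (cornerWord n i) (corner i) = corner i := by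
  induction n with
  | zero => rfl
  | succ n ih =>
    change contr i (wordMap (cornerWord n i) (corner i)) = corner i
    rw [ih, contr, ← two_smul ℝ, smul_smul]
    norm_num

theorem cell_cons (i : Fin 3) (w : Word) : cell (i :: w) = contr i '' cell w :=
  Set.image_comp _ _ _

theorem HorizontalEdge.cons {x y : Word} (h : HorizontalEdge x y) (i : Fin 3) :
    HorizontalEdge (i :: x) (i :: y) := by
  obtain ⟨h1, h2, z, hx, hy⟩ := h
  refine ⟨by simp [h1], by simpa using h2, contr i z, ?_, ?_⟩ <;> rw [cell_cons]
  · exact ⟨z, hx, rfl⟩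
  · exact ⟨z, hy, rfl⟩

/-- The two cells share the midpoint of `corner i` and `corner j`. -/
theorem horizontalEdge_bridge {i j : Fin 3} (hij : i ≠ j) (n : ℕ) :
    HorizontalEdge (i :: cornerWord n j) (j :: cornerWord n i) := by
  refine ⟨by simp, by simp [hij], contr i (corner j), ?_, ?_⟩ <;> rw [cell_cons]
  · exact ⟨corner j, ⟨corner j, corner_mem_gasket j, wordMap_cornerWord n j⟩, rfl⟩
  · refine ⟨corner i, ⟨corner i, corner_mem_gasket i, wordMap_cornerWord n i⟩, ?_⟩
    rw [contr, contr, add_comm]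

open Classical in
/-- The squared difference of `u` along `(x, y)`, if this is a horizontal edge at level `n`. -/
noncomputable def horizontalTerm (n : ℕ) (u : Word → ℝ) (x y : Word) : ℝ≥0∞ :=
  if HorizontalEdge x y ∧ x.length = n then ENNReal.ofReal ((u x - u y) ^ 2) else 0

theorem sum_tsum_cons_le (f : Word → Word → ℝ≥0∞) :
    ∑ i, ∑ j, ∑' x, ∑' y, f (i :: x) (j :: y) ≤ ∑' x, ∑' y, f x y := by
  have hinj : Function.Injective fun p : Fin 3 × Word => p.1 :: p.2 := by
    rintro ⟨i, x⟩ ⟨j, y⟩ h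
    simpa using h
  have hcons : ∀ g : Word → ℝ≥0∞, ∑ i, ∑' x, g (i :: x) ≤ ∑' x, g x := by
    intro g
    have := ENNReal.tsum_comp_le_tsum_of_injective hinj g
    rwa [ENNReal.tsum_prod', tsum_fintype] at this
  calc ∑ i, ∑ j, ∑' x, ∑' y, f (i :: x) (j :: y)
      = ∑ i, ∑' x, ∑ j, ∑' y, f (i :: x) (j :: y) :=
        Finset.sum_congr rfl fun i _ =>
          (Summable.tsum_finsetSum fun j _ => ENNReal.summable).symm
    _ ≤ ∑ i, ∑' x, ∑' y, f (i :: x) y :=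
        Finset.sum_le_sum fun i _ => ENNReal.tsum_le_tsum fun x => hcons _
    _ ≤ ∑' x, ∑' y, f x y := hcons fun x => ∑' y, f x y

theorem bridgeEnergy_eq_sum (x : Fin 3 → Fin 3 → ℝ) :
    bridgeEnergy x = ∑ i, (x i (i + 1) - x (i + 1) i) ^ 2 := by
  rw [Fin.sum_univ_three]
  rfl

/-- Of the nine blocks of pairs given by first letters, the diagonal ones carry the three copies and
the blocks `(i, i + 1)` carry each bridge once; the others are discarded. -/
theorem ofReal_levelEnergy_le (n : ℕ) (u : Word → ℝ) :
    ENNReal.ofReal (levelEnergy n u) ≤ ∑' x, ∑' y, horizontalTerm n u x y := by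
  induction n generalizing u with
  | zero => simp [levelEnergy]
  | succ n ih =>
    refine le_trans ?_ (sum_tsum_cons_le _)
    rw [levelEnergy, bridgeEnergy_eq_sum, ← Finset.sum_add_distrib, ENNReal.ofReal_sum_of_nonneg
      fun i _ => add_nonneg (levelEnergy_nonneg _ _) (sq_nonneg _)]
    refine Finset.sum_le_sum fun i _ => ?_
    have hi : i ≠ i + 1 := by fin_cases i <;> decide
    have h1 : ENNReal.ofReal (levelEnergy n fun w => u (i :: w)) ≤
        ∑' x, ∑' y, horizontalTerm (n + 1) u (i :: x) (i :: y) := by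
      refine (ih _).trans (ENNReal.tsum_le_tsum fun x => ENNReal.tsum_le_tsum fun y => ?_)
      unfold horizontalTerm
      split_ifs with h h'
      · exact le_rfl
      · exact absurd ⟨h.1.cons i, by simp [h.2]⟩ h'
      · exact zero_le
      · exact le_rfl
    have h2 : ENNReal.ofReal ((u (i :: cornerWord n (i + 1)) - u ((i + 1) :: cornerWord n i)) ^ 2) ≤
        ∑' x, ∑' y, horizontalTerm (n + 1) u (i :: x) ((i + 1) :: y) := by
      refine le_trans (le_of_eq ?_) ((ENNReal.le_tsum (cornerWord n i)).trans
        (ENNReal.le_tsum (cornerWord n (i + 1))))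
      rw [horizontalTerm, if_pos ⟨horizontalEdge_bridge hi n, by simp⟩]
    rw [ENNReal.ofReal_add (levelEnergy_nonneg _ _) (sq_nonneg _)]
    refine (add_le_add h1 h2).trans ?_
    rw [← Finset.sum_pair hi
      (f := fun j => ∑' x, ∑' y, horizontalTerm (n + 1) u (i :: x) (j :: y))]
    exact Finset.sum_le_sum_of_subset (Finset.subset_univ _)

theorem IsFather.length_eq {x y : Word} (h : IsFather x y) : y.length = x.length + 1 := by
  have := List.length_pos_iff.2 h.1
  rw [h.2, List.length_dropLast]
  omega

theorem le_conductance_of_horizontalEdge {lam C₁ C₂ : ℝ} (hlam : 0 < lam) {x y : Word}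
    (h : HorizontalEdge x y) :
    min C₁ C₂ / (3 * lam) ^ x.length ≤ conductance lam C₁ C₂ x y := by
  have h1 : ¬ IsFather x y := fun hf => by
    have := hf.length_eq
    have := h.1
    omega
  have h2 : ¬ IsFather y x := fun hf => by
    have := hf.length_eq
    have := h.1
    omega
  rw [conductance, if_neg h1, if_neg h2, if_pos h]
  split_ifs
  · gcongr
    exact min_le_left _ _
  · gcongr
    exact min_le_right _ _

theorem two_mul_energy (lam C₁ C₂ : ℝ) (u : Word → ℝ) : 2 * energy lam C₁ C₂ u =
    ∑' x, ∑' y, ENNReal.ofReal (conductance lam C₁ C₂ x y * (u x - u y) ^ 2) := by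
  rw [energy, ← mul_assoc, one_div, ENNReal.mul_inv_cancel two_ne_zero ENNReal.ofNat_ne_top,
    one_mul]

theorem levelEnergy_le {lam C₁ C₂ : ℝ} (hlam : 0 < lam) (hC₁ : 0 < C₁) (hC₂ : 0 < C₂)
    {u : Word → ℝ} (hE : energy lam C₁ C₂ u < ⊤) (n : ℕ) :
    levelEnergy n u ≤ 2 * (energy lam C₁ C₂ u).toReal / min C₁ C₂ * (3 * lam) ^ n := by
  have hm : 0 < min C₁ C₂ := lt_min hC₁ hC₂
  have hp : 0 < (3 * lam) ^ n := by positivity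
  have h : ENNReal.ofReal (min C₁ C₂ / (3 * lam) ^ n * levelEnergy n u) ≤
      2 * energy lam C₁ C₂ u := by
    rw [ENNReal.ofReal_mul (by positivity), two_mul_energy]
    refine (mul_le_mul_right (ofReal_levelEnergy_le n u) _).trans ?_
    rw [← ENNReal.tsum_mul_left]
    refine ENNReal.tsum_le_tsum fun x => ?_
    rw [← ENNReal.tsum_mul_left]
    refine ENNReal.tsum_le_tsum fun y => ?_
    unfold horizontalTerm
    split_ifs with hxy
    · rw [← ENNReal.ofReal_mul (by positivity), ← hxy.2]
      exact ENNReal.ofReal_le_ofReal (mul_le_mul_of_nonneg_right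
        (le_conductance_of_horizontalEdge hlam hxy.1) (sq_nonneg _))
    · simp
  have h' := (ENNReal.ofReal_le_iff_le_toReal
    (ENNReal.mul_ne_top ENNReal.ofNat_ne_top hE.ne)).1 h
  rw [ENNReal.toReal_mul, ENNReal.toReal_ofNat, div_mul_eq_mul_div, div_le_iff₀ hp] at h'
  rw [div_mul_eq_mul_div, le_div_iff₀ hm]
  linarith

theorem isFather_cornerWord (n : ℕ) (i : Fin 3) :
    IsFather (cornerWord n i) (cornerWord (n + 1) i) := by
  simp [IsFather, cornerWord]

theorem sq_sub_cornerWord_succ_le {lam C₁ C₂ : ℝ} (hlam : 0 < lam)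
    {u : Word → ℝ} (hE : energy lam C₁ C₂ u < ⊤) (n : ℕ) (i : Fin 3) :
    (u (cornerWord n i) - u (cornerWord (n + 1) i)) ^ 2 ≤
      2 * (energy lam C₁ C₂ u).toReal * (3 * lam) ^ n := by
  have hp : 0 < (3 * lam) ^ n := by positivity
  have h : ENNReal.ofReal (1 / (3 * lam) ^ n *
      (u (cornerWord n i) - u (cornerWord (n + 1) i)) ^ 2) ≤ 2 * energy lam C₁ C₂ u := by
    rw [two_mul_energy]
    refine le_trans (le_of_eq ?_) ((ENNReal.le_tsum (cornerWord n i)).trans'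
      (ENNReal.le_tsum (cornerWord (n + 1) i)))
    rw [conductance, if_pos (isFather_cornerWord n i), List.length_replicate]
  have h' := (ENNReal.ofReal_le_iff_le_toReal
    (ENNReal.mul_ne_top ENNReal.ofNat_ne_top hE.ne)).1 h
  rwa [ENNReal.toReal_mul, ENNReal.toReal_ofNat, one_div_mul_eq_div, div_le_iff₀ hp] at h'

/-! ### Convergence at infinity and boundary values -/

open Filter Topology in
/-- A function of finite energy converges at infinity if `λ < 1/5`. -/
theorem exists_tendsto_cofinite {lam C₁ C₂ : ℝ} (hlam : 0 < lam) (hlam' : lam < 1 / 5)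
    (hC₁ : 0 < C₁) (hC₂ : 0 < C₂) {u : Word → ℝ} (hE : energy lam C₁ C₂ u < ⊤) :
    ∃ a : ℝ, Tendsto u cofinite (𝓝 a) := by
  set E : ℝ := 2 * (energy lam C₁ C₂ u).toReal
  have hE0 : 0 ≤ E := by positivity
  have hcauchy : CauchySeq fun n => u (cornerWord n 0) := by
    refine cauchySeq_of_le_geometric √(3 * lam) √E ?_ fun n => ?_
    · rw [Real.sqrt_lt' one_pos]
      linarith
    · rw [Real.dist_eq]
      refine abs_le_of_sq_le_sq ?_ (by positivity)
      rw [mul_pow, Real.sq_sqrt hE0, pow_right_comm, Real.sq_sqrt (by positivity)]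
      exact sq_sub_cornerWord_succ_le hlam hE n 0
  obtain ⟨a, ha⟩ := cauchySeq_tendsto_of_complete hcauchy
  -- Levels are finite, so leaving every finite set means that the length tends to infinity.
  have hlen : Tendsto (List.length : Word → ℕ) cofinite atTop := by
    refine tendsto_atTop.2 fun N => ?_
    filter_upwards [(List.finite_length_lt (Fin 3) N).compl_mem_cofinite] with x hx
    simpa using hx
  have hsmall : Tendsto (fun n : ℕ => 10 * √(E / min C₁ C₂) * √(5 * lam) ^ n) atTop (𝓝 0) := by
    rw [← mul_zero (10 * √(E / min C₁ C₂))]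
    refine (tendsto_pow_atTop_nhds_zero_of_lt_one (Real.sqrt_nonneg _) ?_).const_mul _
    rw [Real.sqrt_lt' one_pos]
    linarith
  have hosc : ∀ x, |u x - u (cornerWord x.length 0)| ≤
      10 * √(E / min C₁ C₂) * √(5 * lam) ^ x.length := by
    intro x
    have hm : 0 < min C₁ C₂ := lt_min hC₁ hC₂
    refine (abs_sub_corner_le _ u x rfl 0).trans ?_
    have h1 := Real.sqrt_le_sqrt (levelEnergy_le hlam hC₁ hC₂ hE x.length)
    rw [Real.sqrt_mul (by positivity)] at h1
    have h2 : √(5 * lam) ^ x.length = √(5 / 3) ^ x.length * √((3 * lam) ^ x.length) := by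
      have h3 : √((3 * lam) ^ x.length) = √(3 * lam) ^ x.length := by
        rw [← Real.sqrt_sq (by positivity : 0 ≤ √(3 * lam) ^ x.length), pow_right_comm,
          Real.sq_sqrt (by positivity)]
      rw [h3, ← mul_pow, ← Real.sqrt_mul (by norm_num)]
      ring_nf
    rw [h2]
    calc _ ≤ 10 * √(5 / 3) ^ x.length * (√(E / min C₁ C₂) * √((3 * lam) ^ x.length)) := by gcongr
      _ = _ := by ring
  refine ⟨a, ?_⟩
  have h0 : Tendsto (fun x => u x - u (cornerWord x.length 0)) cofinite (𝓝 0) :=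
    squeeze_zero_norm hosc (hsmall.comp hlen)
  simpa using h0.add (ha.comp hlen)

open Filter Topology in
-- Neighbourhoods of `ξ` trace a filter on the nodes: proper by density, and finer than cofinite
-- because `ξ` is not a node. The form of the Martin kernel plays no role.
theorem eq_of_mem_martinBoundary {lam C₁ C₂ : ℝ} {u : MartinCompactification lam C₁ C₂ → ℝ}
    (hu : Continuous u) {a : ℝ}
    (ha : Tendsto (fun x => u (toMartin lam C₁ C₂ x)) cofinite (𝓝 a))
    {ξ : MartinCompactification lam C₁ C₂} (hξ : ξ ∈ martinBoundary lam C₁ C₂) : u ξ = a := by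
  have hj := isKernelCompactification_martin lam C₁ C₂
  have hne : (comap (toMartin lam C₁ C₂) (𝓝 ξ)).NeBot :=
    comap_neBot_iff_frequently.2 (mem_closure_iff_frequently.1 (hj.dense ξ))
  have hle : comap (toMartin lam C₁ C₂) (𝓝 ξ) ≤ cofinite := by
    refine le_cofinite_iff_compl_singleton_mem.2 fun x => ?_
    refine ⟨{toMartin lam C₁ C₂ x}ᶜ, isOpen_compl_singleton.mem_nhds ?_, ?_⟩
    · rintro rfl
      exact hξ ⟨x, rfl⟩
    · rintro y hy rfl
      exact hy rfl
  exact tendsto_nhds_unique (hu.continuousAt.tendsto.comp tendsto_comap) (ha.mono_left hle)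

end SierpinskiWalk

theorem mainTheorem4 (lam C₁ C₂ : ℝ) (hlam : 0 < lam) (hlam' : lam < 1 / 5)
    (hC₁ : 0 < C₁) (hC₂ : 0 < C₂)
    (u : SierpinskiWalk.MartinCompactification lam C₁ C₂ → ℝ) (hu : Continuous u)
    (hE : SierpinskiWalk.energy lam C₁ C₂
      (fun x => u (SierpinskiWalk.toMartin lam C₁ C₂ x)) < ⊤) :
    ∃ a : ℝ, ∀ ξ ∈ SierpinskiWalk.martinBoundary lam C₁ C₂, u ξ = a := by
  obtain ⟨a, ha⟩ := SierpinskiWalk.exists_tendsto_cofinite hlam hlam' hC₁ hC₂ hE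
  exact ⟨a, fun ξ hξ => SierpinskiWalk.eq_of_mem_martinBoundary hu ha hξ⟩
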